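/- Let $G$ be a finite simple graph. A cycle packing of $G$ is a set of pairwise vertex-disjoint cycles that are subgraphs of $G$, and $\mathrm{cp}(G)$ denotes the maximum size of a cycle packing of $G$. A feedback vertex set of $G$ is a set $S$ of vertices such that $G\setminus S$ is a forest, and $\mathrm{fvs}(G)$ denotes the minimum size of a feedback vertex set of $G$. Call $G$ a based planar graph if it has an embedding in the plane with a face that is adjacent to every other face, where two faces are adjacent if some edge has one of them on one side and the other one on the other side; $G$ need not be connected. Theorem. Every based planar graph $G$ satisfies $$\mathrm{fvs}(G)\le 2\,\mathrm{cp}(G).$$ Consequently, for every integer $k \ge 0$, if $G$ does not contain $k+1$ pairwise vertex-disjoint cycles, then there is a set of at most $2k$ vertices of $G$ whose deletion leaves a forest. -/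

import Mathlib

/-- A combinatorial drawing of a simple graph `G`: a rotation system (a cyclic order of the darts
around every vertex), together with a labelling of the boundary walks by faces.

In a drawing of a disconnected graph one face can be bounded by several closed walks and by
isolated vertices, so the faces are not merely the facial walks: `face d` is the face
on a fixed side of the dart `d`, and `isolatedFace v h` is the face in which the isolated vertex
`v` lies. -/
structure GraphDrawing {V : Type*} (G : SimpleGraph V) where
  /-- the dart that follows a given dart in the cyclic order around its initial vertex -/
  rot : Equiv.Perm G.Dart
  rot_fst : ∀ d : G.Dart, (rot d).fst = d.fst
  /-- the darts at a vertex form a single cycle of the rotation -/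
  rot_cyclic : ∀ d e : G.Dart, d.fst = e.fst → rot.SameCycle d e
  /-- the faces -/
  Face : Type
  finite_face : Finite Face
  /-- the face that has the dart on its boundary walk -/
  face : G.Dart → Face
  /-- traverse `d`, then leave its end by the dart following the reversal of `d`: this stays on the
  boundary of the same face -/
  face_next : ∀ d : G.Dart, face (rot d.symm) = face d
  /-- the face that contains an isolated vertex -/
  isolatedFace : ∀ v : V, (∀ w : V, ¬ G.Adj v w) → Face

namespace GraphDrawing

/-- The vertex `v` lies on the boundary of the face `f`. -/
def OnBoundary {V : Type*} {G : SimpleGraph V} (M : GraphDrawing G) (v : V) (f : M.Face) : Prop :=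
  (∃ d : G.Dart, d.fst = v ∧ M.face d = f) ∨
    ∃ h : ∀ w : V, ¬ G.Adj v w, M.isolatedFace v h = f

/-- The bipartite incidence graph between the vertices and the faces of a drawing. -/
def incidenceGraph {V : Type*} {G : SimpleGraph V} (M : GraphDrawing G) :
    SimpleGraph (V ⊕ M.Face) :=
  SimpleGraph.fromRel fun a b => ∃ v f, a = Sum.inl v ∧ b = Sum.inr f ∧ M.OnBoundary v f

/-- The drawing is a drawing in the plane (equivalently, on the sphere): the whole drawing is
connected through its vertices and faces, and Euler's formula `|V| - |E| + |F| = 1 + c` holds,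
where `c` is the number of connected components of the graph.

Why this is planarity: let `W` be the number of boundary components, that is, of orbits
of `d ↦ rot d.symm` plus isolated vertices, and let `g` be the sum of the genera of the rotation
systems of the `c` components of `G`, so that `|V| - |E| + W = 2c - 2g`. The multigraph on the
components and the faces, with one edge for each boundary component, is connected, so
`c + |F| ≤ W + 1`. Euler's formula then says exactly that `g = 0` and that this multigraph is
a tree: every component is drawn on the sphere, and the components are placed inside one
another's faces in a tree-like way. -/
def IsPlane {V : Type*} {G : SimpleGraph V} (M : GraphDrawing G) : Prop :=
  M.incidenceGraph.Connected ∧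
    Nat.card V + Nat.card M.Face = Nat.card G.edgeSet + Nat.card G.ConnectedComponent + 1

/-- Two faces are adjacent: some edge has one of them on one side and the other one on the
other side. -/
def FacesAdjacent {V : Type*} {G : SimpleGraph V} (M : GraphDrawing G) (f g : M.Face) : Prop :=
  ∃ d : G.Dart, M.face d = f ∧ M.face d.symm = g

end GraphDrawing

namespace SimpleGraph

/-- A based planar graph: it has a drawing in the plane with a face that is adjacent to every
other face. -/
def IsBasedPlanar {V : Type*} (G : SimpleGraph V) : Prop :=
  ∃ M : GraphDrawing G, M.IsPlane ∧ ∃ f₀ : M.Face, ∀ f : M.Face, f ≠ f₀ → M.FacesAdjacent f₀ f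

/-- A subgraph that is a cycle. -/
def Subgraph.IsCycleSubgraph {V : Type*} {G : SimpleGraph V} (H : G.Subgraph) : Prop :=
  ∃ (v : V) (c : G.Walk v v), c.IsCycle ∧ H = c.toSubgraph

/-- A cycle packing: a set of pairwise vertex-disjoint cycles of `G`. -/
def IsCyclePacking {V : Type*} (G : SimpleGraph V) (P : Finset G.Subgraph) : Prop :=
  (∀ H ∈ P, H.IsCycleSubgraph) ∧ (P : Set G.Subgraph).Pairwise fun H K => Disjoint H.verts K.verts

/-- `cp(G)`: the maximum size of a cycle packing. -/
noncomputable def cyclePackingNumber {V : Type*} (G : SimpleGraph V) : ℕ :=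
  sSup {n : ℕ | ∃ P : Finset G.Subgraph, G.IsCyclePacking P ∧ P.card = n}

/-- A feedback vertex set: deleting it leaves a forest. -/
def IsFeedbackVertexSet {V : Type*} (G : SimpleGraph V) (S : Finset V) : Prop :=
  (G.induce ((S : Set V)ᶜ)).IsAcyclic

/-- `fvs(G)`: the minimum size of a feedback vertex set. -/
noncomputable def feedbackVertexNumber {V : Type*} (G : SimpleGraph V) : ℕ :=
  sInf {n : ℕ | ∃ S : Finset V, G.IsFeedbackVertexSet S ∧ S.card = n}

/-- In a finite graph the maximum in the definition of `cp(G)` is attained. -/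
theorem exists_isCyclePacking_card_eq {V : Type*} [Finite V] (G : SimpleGraph V) :
    ∃ P : Finset G.Subgraph, G.IsCyclePacking P ∧ P.card = G.cyclePackingNumber := by
  have hb : BddAbove {n : ℕ | ∃ P : Finset G.Subgraph, G.IsCyclePacking P ∧ P.card = n} := by
    have := Fintype.ofFinite G.Subgraph
    refine ⟨Fintype.card G.Subgraph, ?_⟩
    rintro n ⟨P, -, rfl⟩
    exact P.card_le_univ
  have hne : {n : ℕ | ∃ P : Finset G.Subgraph, G.IsCyclePacking P ∧ P.card = n}.Nonempty :=
    ⟨0, ∅, by simp [IsCyclePacking], by simp⟩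
  exact Nat.sSup_mem hne hb

/-- In a finite graph the minimum in the definition of `fvs(G)` is attained. -/
theorem exists_isFeedbackVertexSet_card_eq {V : Type*} [Finite V] (G : SimpleGraph V) :
    ∃ S : Finset V, G.IsFeedbackVertexSet S ∧ S.card = G.feedbackVertexNumber := by
  have := Fintype.ofFinite V
  refine Nat.sInf_mem (s := {n : ℕ | ∃ S : Finset V, G.IsFeedbackVertexSet S ∧ S.card = n})
    ⟨_, Finset.univ, ?_, rfl⟩
  intro v
  exact absurd v.2 (by simp)

end SimpleGraph

/-! ### Acyclic vertex sets -/

namespace SimpleGraph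

variable {V : Type*} {G : SimpleGraph V}

/-! For each face other than the base face `f₀`, choose one edge between it and `f₀`. A face occurs
equally often on the two sides of the darts leaving a vertex set. So a chosen edge for `f` that
crosses a cut forces a second edge on the boundary of `f` to cross it, and that edge is not chosen
(`exists_leaving_face_not_chosen`). Hence deleting the chosen edges keeps the components, and
Euler's formula leaves exactly |V| - c edges: a spanning forest. The descendants of `v` are left by
only one forest edge, the one to the parent, so a chosen edge leaving them belongs to one of the two
faces beside that edge. At most two chosen edges leave: the forest is thin
(`IsBasedPlanar.exists_isThinForest`).

Thinness alone gives the bound (`IsThinForest.exists_packing`). Take a lowest `x` whose descendants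
within `U` contain a cycle. Either these descendants or a suitable union of child branches
(`IsThinForest.exists_pendant`) contributes one cycle to the packing. Deleting `x` and one further
vertex makes this part acyclic and leaves at most one edge from it to the rest, so by
`AcyclicOn.union` induction applies to the rest of `U`. Each cycle costs two vertices. -/

/-- No cycle of `G` has all its vertices in `A`. -/
def AcyclicOn (G : SimpleGraph V) (A : Set V) : Prop :=
  ∀ (v : V) (c : G.Walk v v), c.IsCycle → ∃ w ∈ c.support, w ∉ A

theorem AcyclicOn.mono {A B : Set V} (hB : G.AcyclicOn B) (h : A ⊆ B) : G.AcyclicOn A := by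
  intro v c hc
  obtain ⟨w, hw, hwB⟩ := hB v c hc
  exact ⟨w, hw, fun hA => hwB (h hA)⟩

theorem AcyclicOn.isAcyclic_induce {A : Set V} (h : G.AcyclicOn A) : (G.induce A).IsAcyclic := by
  intro v c hc
  obtain ⟨w, hw, hwA⟩ := h _ (c.map (Embedding.induce A).toHom)
    (hc.map (Embedding.induce (G := G) A).injective)
  rw [Walk.support_map, List.mem_map] at hw
  obtain ⟨a, -, rfl⟩ := hw
  exact hwA a.2

/-- Two acyclic vertex sets joined by at most one edge have an acyclic union. -/
theorem AcyclicOn.union {A B : Set V} (hA : G.AcyclicOn A) (hB : G.AcyclicOn B)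
    (h : ∀ a ∈ A, ∀ b ∈ B, ∀ a' ∈ A, ∀ b' ∈ B, G.Adj a b → G.Adj a' b' → s(a, b) = s(a', b')) :
    G.AcyclicOn (A ∪ B) := by
  classical
  intro v c hc
  by_contra! hcon
  obtain ⟨w, hw, hwA⟩ := hA v c hc
  obtain ⟨u, hu, huB⟩ := hB v c hc
  have hwB : w ∈ B := (hcon w hw).resolve_left hwA
  have huA : u ∈ A := (hcon u hu).resolve_right huB
  set c' := c.rotate u hu with hc'
  have hcyc : c'.IsCycle := hc.rotate hu
  have hsup : ∀ t ∈ c'.support, t ∈ A ∪ B := fun t ht =>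
    hcon t (by rwa [hc', Walk.mem_support_rotate_iff] at ht)
  have hw' : w ∈ c'.support := by rwa [hc', Walk.mem_support_rotate_iff]
  -- The arc from `u` to `w` leaves `A` and the arc back leaves `B`. Both crossings join `A` to `B`,
  -- so they would be one edge used twice by a cycle.
  obtain ⟨d, hd, hd1, hd2⟩ := (c'.takeUntil w hw').exists_boundary_dart A huA hwA
  obtain ⟨d', hd', hd1', hd2'⟩ := (c'.dropUntil w hw').exists_boundary_dart B hwB huB
  have hmem : d ∈ c'.darts := c'.darts_takeUntil_subset_darts hw' hd
  have hmem' : d' ∈ c'.darts := c'.darts_dropUntil_subset_darts hw' hd'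
  have hB2 : d.snd ∈ B := (hsup _ (c'.dart_snd_mem_support_of_mem_darts hmem)).resolve_left hd2
  have hA2 : d'.snd ∈ A := (hsup _ (c'.dart_snd_mem_support_of_mem_darts hmem')).resolve_right hd2'
  have heq : d.edge = d'.edge := by
    have := h _ hd1 _ hB2 _ hA2 _ hd1' d.adj d'.adj.symm
    rw [Sym2.eq_swap (a := d'.snd)] at this
    exact this
  have hnd := hcyc.isTrail.edges_nodup
  rw [← c'.take_spec hw', Walk.edges_append, List.nodup_append] at hnd
  exact hnd.2.2 _ (List.mem_map_of_mem hd) _ (List.mem_map_of_mem hd') heq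

/-! ### Descendants under a parent map -/

/-- The vertices that reach `v` by iterating the parent map `p`. -/
def descendants (p : V → V) (v : V) : Set V := {u | ∃ n : ℕ, p^[n] u = v}

section Descendants

variable {p : V → V}

theorem self_mem_descendants (v : V) : v ∈ descendants p v := ⟨0, rfl⟩

theorem mem_descendants_of_parent {u v : V} (h : p u ∈ descendants p v) :
    u ∈ descendants p v := by
  obtain ⟨n, hn⟩ := h
  exact ⟨n + 1, hn⟩

theorem parent_mem_descendants {u v : V} (h : u ∈ descendants p v) (huv : u ≠ v) :
    p u ∈ descendants p v := by
  obtain ⟨n, hn⟩ := h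
  cases n with
  | zero => exact absurd hn huv
  | succ n => exact ⟨n, hn⟩

theorem descendants_subset_of_parent (y : V) : descendants p y ⊆ descendants p (p y) := by
  rintro u ⟨n, rfl⟩
  exact ⟨n + 1, Function.iterate_succ_apply' p n u⟩

theorem exists_child_of_mem_descendants {u x : V} (h : u ∈ descendants p x) (hux : u ≠ x) :
    ∃ y, p y = x ∧ y ≠ x ∧ u ∈ descendants p y := by
  classical
  -- The least number of iterations is needed: `x` may be a fixed point of `p`, and minimality keeps
  -- the preceding vertex different from `x`.
  have hpos : Nat.find h ≠ 0 := fun h0 => hux (by simpa [h0] using Nat.find_spec h)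
  obtain ⟨n, hn⟩ := Nat.exists_eq_succ_of_ne_zero hpos
  refine ⟨p^[n] u, ?_, Nat.find_min h (by omega), n, rfl⟩
  rw [← Function.iterate_succ_apply' p n u, ← hn]
  exact Nat.find_spec h

variable {rank : V → ℕ} (hrank : ∀ v, p v ≠ v → rank (p v) < rank v)
include hrank

theorem rank_le_of_mem_descendants {u v : V} (h : u ∈ descendants p v) : rank v ≤ rank u := by
  obtain ⟨n, rfl⟩ := h
  induction n generalizing u with
  | zero => exact le_rfl
  | succ n ih =>
    refine (ih (u := p u)).trans ?_
    by_cases h : p u = u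
    · rw [h]
    · exact (hrank u h).le

theorem parent_notMem_descendants {y : V} (hy : p y ≠ y) : p y ∉ descendants p y := fun h =>
  (hrank y hy).not_ge (rank_le_of_mem_descendants hrank h)

theorem descendants_root {r : V} (hroot : ∀ v, p v = v → v = r) (u : V) :
    u ∈ descendants p r := by
  induction h : rank u using Nat.strong_induction_on generalizing u with
  | _ n ih =>
    by_cases hu : p u = u
    · rw [← hroot u hu]
      exact self_mem_descendants u
    · exact mem_descendants_of_parent (ih _ (h ▸ hrank u hu) _ rfl)

end Descendants

/-! ### Packing and covering along a thin forest -/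

/-- Apart from the edge from `v` to its parent, at most two edges leave the set of descendants of
`v`. -/
def IsThinForest (G : SimpleGraph V) (p : V → V) : Prop :=
  ∀ v, ∃ e₁ e₂ : Sym2 V, ∀ a ∈ descendants p v, ∀ b ∉ descendants p v, G.Adj a b →
    ¬ (a = v ∧ b = p v) → s(a, b) = e₁ ∨ s(a, b) = e₂

theorem Sym2_cross_eq {D : Set V} {a b a' b' : V} (ha : a ∈ D) (hb' : b' ∉ D)
    (h : s(a, b) = s(a', b')) : a = a' ∧ b = b' := by
  rcases Sym2.eq_iff.1 h with h | h
  · exact h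
  · exact absurd (h.1 ▸ ha) hb'

/-- If all children of `x` have acyclic sets of descendants within `U`, but the descendants of `x`
other than `x` do contain a cycle, then there is a set `R` of such descendants that contains a
cycle, loses all its cycles when one vertex is deleted, and is joined to the remaining vertices of
`U` only through `x`. -/
theorem IsThinForest.exists_pendant [Finite V] {p : V → V} (hthin : G.IsThinForest p)
    {rank : V → ℕ} (hrank : ∀ v, p v ≠ v → rank (p v) < rank v) {U : Set V} {x : V}
    (hch : ∀ y, p y = x → y ≠ x → G.AcyclicOn (descendants p y ∩ U))
    (hW : ¬ G.AcyclicOn ((descendants p x ∩ U) \ {x})) :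
    ∃ R ⊆ U, ∃ z, ¬ G.AcyclicOn R ∧ G.AcyclicOn (R \ {z}) ∧
      ∀ a ∈ R, ∀ b ∈ U \ R, G.Adj a b → b = x := by
  let R : Set V → Set V := fun Y => {u | u ∈ U ∧ ∃ y ∈ Y, u ∈ descendants p y}
  -- A minimal set of children whose branches together contain a cycle.
  obtain ⟨Y, hY⟩ := Set.Finite.exists_minimal
    (s := {Y : Set V | (∀ y ∈ Y, p y = x ∧ y ≠ x) ∧ ¬ G.AcyclicOn (R Y)}) (Set.toFinite _)
    ⟨{y | p y = x ∧ y ≠ x}, fun y hy => hy, fun h => hW (h.mono (by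
      rintro u ⟨⟨hux, huU⟩, hne⟩
      obtain ⟨y, h1, h2, h3⟩ := exists_child_of_mem_descendants hux hne
      exact ⟨huU, y, ⟨h1, h2⟩, h3⟩))⟩
  obtain ⟨⟨hYx, hYac⟩, hYmin⟩ := hY
  have hBac : ∀ y ∈ Y, G.AcyclicOn (R Y \ descendants p y) := by
    intro y hy
    by_contra hcon
    have hmem := hYmin (y := Y \ {y}) ⟨fun t ht => hYx t ht.1, fun h => hcon (h.mono (by
      rintro u ⟨⟨huU, t, ht, hut⟩, huy⟩
      refine ⟨huU, t, ⟨ht, ?_⟩, hut⟩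
      rintro rfl
      exact huy hut))⟩ Set.sdiff_subset
    exact (hmem hy).2 rfl
  have hxR : ∀ y ∈ Y, x ∉ descendants p y := by
    intro y hy
    obtain ⟨h1, h2⟩ := hYx y hy
    have := parent_notMem_descendants hrank (y := y) (by rw [h1]; exact h2.symm)
    rwa [h1] at this
  have hxR' : x ∉ R Y := fun ⟨_, y, hy, hxy⟩ => hxR y hy hxy
  have hsplit : ∀ y, R Y ⊆ (descendants p y ∩ U) ∪ (R Y \ descendants p y) := by
    intro y u hu
    by_cases h : u ∈ descendants p y
    · exact Or.inl ⟨h, hu.1⟩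
    · exact Or.inr ⟨hu, h⟩
  -- two edges join the part below `y` to the other parts, and no other edge avoids `x`
  have key : ∀ y ∈ Y, ∃ a ∈ descendants p y, ∃ b ∈ R Y, ∃ a' ∈ descendants p y, ∃ b' ∈ R Y,
      s(a, b) ≠ s(a', b') ∧
      ∀ c ∈ descendants p y, ∀ d ∉ descendants p y, G.Adj c d → d ≠ x →
        s(c, d) = s(a, b) ∨ s(c, d) = s(a', b') := by
    intro y hy
    -- The branch at `y` is acyclic, and so are the other branches by minimality, but their union is
    -- not. So two edges join them; neither ends in `x`, so they are the two exits that thinness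
    -- allows.
    have hne : ¬ G.AcyclicOn ((descendants p y ∩ U) ∪ (R Y \ descendants p y)) :=
      fun h => hYac (h.mono (hsplit y))
    have : ∃ a ∈ descendants p y ∩ U, ∃ b ∈ R Y \ descendants p y,
        ∃ a' ∈ descendants p y ∩ U, ∃ b' ∈ R Y \ descendants p y,
        G.Adj a b ∧ G.Adj a' b' ∧ s(a, b) ≠ s(a', b') := by
      by_contra! hcon
      exact hne (AcyclicOn.union (hch y (hYx y hy).1 (hYx y hy).2) (hBac y hy) hcon)
    obtain ⟨a, ha, b, hb, a', ha', b', hb', hab, hab', hne'⟩ := this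
    obtain ⟨e₁, e₂, he⟩ := hthin y
    refine ⟨a, ha.1, b, hb.1, a', ha'.1, b', hb'.1, hne', fun c hc d hd hcd hdx => ?_⟩
    have hx : p y = x := (hYx y hy).1
    have h1 := he a ha.1 b hb.2 hab (fun h => hxR' (by rw [← hx, ← h.2]; exact hb.1))
    have h2 := he a' ha'.1 b' hb'.2 hab' (fun h => hxR' (by rw [← hx, ← h.2]; exact hb'.1))
    have h3 := he c hc d hd hcd (fun h => hdx (by rw [← hx, ← h.2]))
    grind
  have hYne : Y.Nonempty := by
    by_contra hcon
    rw [Set.not_nonempty_iff_eq_empty] at hcon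
    refine hYac fun v c _ => ⟨v, c.start_mem_support, ?_⟩
    rintro ⟨_, y, hy, _⟩
    simp [hcon] at hy
  obtain ⟨y₀, hy₀⟩ := hYne
  -- Deleting an end `z` of one of the two edges leaves at most one edge between two acyclic sets.
  obtain ⟨z, hz, b, hb, a', ha', b', hb', hne, hall⟩ := key y₀ hy₀
  refine ⟨R Y, fun u hu => hu.1, z, hYac, ?_, ?_⟩
  · refine (AcyclicOn.union
      (A := (descendants p y₀ ∩ U) \ {z}) (B := R Y \ descendants p y₀)
      ((hch y₀ (hYx y₀ hy₀).1 (hYx y₀ hy₀).2).mono Set.sdiff_subset) (hBac y₀ hy₀) ?_).mono ?_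
    · have aux : ∀ c ∈ (descendants p y₀ ∩ U) \ {z}, ∀ d ∈ R Y \ descendants p y₀,
          G.Adj c d → s(c, d) = s(a', b') := by
        intro c hc d hd hcd
        refine (hall c hc.1.1 d hd.2 hcd (fun h => hxR' (h ▸ hd.1))).resolve_left fun h => hc.2 ?_
        rcases Sym2.eq_iff.1 h with h | h
        · exact h.1
        · exact absurd (h.2 ▸ hz) hd.2
      intro c hc d hd c' hc' d' hd' h h'
      rw [aux c hc d hd h, aux c' hc' d' hd' h']
    · rintro u ⟨hu, huz⟩
      rcases hsplit y₀ hu with h | h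
      · exact Or.inl ⟨h, huz⟩
      · exact Or.inr h
  · rintro a ⟨haU, y, hy, hay⟩ d ⟨hdU, hdR⟩ hadj
    -- An edge from the branch at `y` that avoids `x` is one of its two exits, and both stay inside
    -- `R Y`.
    by_contra hdx
    obtain ⟨a₁, ha₁, b₁, hb₁, a₂, ha₂, b₂, hb₂, -, hall'⟩ := key y hy
    have hd : d ∉ descendants p y := fun h => hdR ⟨hdU, y, hy, h⟩
    rcases hall' a hay d hd hadj hdx with h | h <;> rcases Sym2.eq_iff.1 h with h | h
    · exact hdR (h.2 ▸ hb₁)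
    · exact hd (h.2 ▸ ha₁)
    · exact hdR (h.2 ▸ hb₂)
    · exact hd (h.2 ▸ ha₂)

theorem exists_insert_packing {Q : Finset (Set V)} {U' A : Set V}
    (hQ : ∀ B ∈ Q, B ⊆ U' ∧ ¬ G.AcyclicOn B) (hQd : (Q : Set (Set V)).Pairwise Disjoint)
    (hA : ¬ G.AcyclicOn A) (hAU : Disjoint A U') {U : Set V} (hAU2 : A ⊆ U) (hU' : U' ⊆ U) :
    ∃ Q' : Finset (Set V), (∀ B ∈ Q', B ⊆ U ∧ ¬ G.AcyclicOn B) ∧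
      (Q' : Set (Set V)).Pairwise Disjoint ∧ Q'.card = Q.card + 1 := by
  classical
  have hd : ∀ B ∈ Q, Disjoint A B := fun B hB => hAU.mono_right (hQ B hB).1
  refine ⟨insert A Q, ?_, ?_, Finset.card_insert_of_notMem fun h => hA ?_⟩
  · intro B hB
    rcases Finset.mem_insert.1 hB with rfl | hB
    · exact ⟨hAU2, hA⟩
    · exact ⟨(hQ B hB).1.trans hU', (hQ B hB).2⟩
  · rw [Finset.coe_insert]
    exact hQd.insert fun B hB _ => ⟨hd B hB, (hd B hB).symm⟩
  · have := disjoint_self.1 (hd A h)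
    intro v c _
    exact ⟨v, c.start_mem_support, by simp [this]⟩

/-- In a graph with a thin forest, some `S` meets all cycles within `U` and has at most twice the
size of some family of pairwise disjoint subsets of `U` that contain cycles. -/
theorem IsThinForest.exists_packing [Finite V] {p : V → V} (hthin : G.IsThinForest p)
    {rank : V → ℕ} (hrank : ∀ v, p v ≠ v → rank (p v) < rank v)
    {r : V} (hroot : ∀ v, p v = v → v = r) (U : Set V) :
    ∃ (S : Finset V) (Q : Finset (Set V)), (∀ A ∈ Q, A ⊆ U ∧ ¬ G.AcyclicOn A) ∧
      (Q : Set (Set V)).Pairwise Disjoint ∧ S.card ≤ 2 * Q.card ∧ G.AcyclicOn (U \ S) := by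
  classical
  induction hn : U.ncard using Nat.strong_induction_on generalizing U with
  | _ n ih =>
  subst hn
  by_cases hU : G.AcyclicOn U
  · exact ⟨∅, ∅, by simp, by simp, by simp, by simpa using hU⟩
  -- The root `r` is a candidate, since every vertex descends from it.
  obtain ⟨x, hx⟩ := Set.Finite.exists_minimalFor (fun v => (descendants p v).ncard)
    {v | ¬ G.AcyclicOn (descendants p v ∩ U)} (Set.toFinite _)
    ⟨r, fun h => hU (h.mono fun u hu => ⟨descendants_root hrank hroot u, hu⟩)⟩
  obtain ⟨hxac, hxmin⟩ := hx
  have hch : ∀ y, p y = x → y ≠ x → G.AcyclicOn (descendants p y ∩ U) := by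
    rintro y rfl hyx
    by_contra hcon
    have h1 := hxmin hcon
    have h2 : descendants p y ⊂ descendants p (p y) :=
      ⟨descendants_subset_of_parent y, fun h =>
        parent_notMem_descendants hrank (Ne.symm hyx) (h (self_mem_descendants _))⟩
    have h3 := Set.ncard_lt_ncard h2 (Set.toFinite _)
    have h4 := h1 h3.le
    simp only at h4
    omega
  -- Splitting off `A` adds one packing member and so pays for two more deleted vertices. The forest
  -- is not restricted to `U`, so thinness persists.
  have step : ∀ A ⊆ U, ¬ G.AcyclicOn A →
      ∃ (S : Finset V) (Q : Finset (Set V)), (∀ B ∈ Q, B ⊆ U ∧ ¬ G.AcyclicOn B) ∧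
      (Q : Set (Set V)).Pairwise Disjoint ∧ S.card + 2 ≤ 2 * Q.card ∧
      G.AcyclicOn ((U \ A) \ S) := by
    intro A hAU hA
    have hss : U \ A ⊂ U := by
      refine ⟨Set.sdiff_subset, fun h => hA ?_⟩
      have hempty : ∀ v, v ∉ A := fun v hv => (h (hAU hv)).2 hv
      exact fun v c _ => ⟨v, c.start_mem_support, hempty v⟩
    obtain ⟨S, Q, hQ, hQd, hcard, hac⟩ := ih _ (Set.ncard_lt_ncard hss (Set.toFinite _)) _ rfl
    obtain ⟨Q', h1, h2, h3⟩ := exists_insert_packing hQ hQd hA Set.disjoint_sdiff_right hAU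
      (Set.sdiff_subset (s := U) (t := A))
    exact ⟨S, Q', h1, h2, by omega, hac⟩
  have hcard2 : ∀ (S : Finset V) (z : V), (insert x (insert z S)).card ≤ S.card + 2 := by
    intro S z
    have h1 := Finset.card_insert_le x (insert z S)
    have h2 := Finset.card_insert_le z S
    omega
  by_cases hW : G.AcyclicOn ((descendants p x ∩ U) \ {x})
  · obtain ⟨S, Q, hQ, hQd, hcard, hac⟩ := step _ Set.inter_subset_right hxac
    obtain ⟨e₁, e₂, he⟩ := hthin x
    -- Deleting `x` removes the parent edge; taking `z` as the inner end of one of the two other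
    -- exits leaves at most one exit.
    obtain ⟨z, hz⟩ : ∃ z, ∀ a ∈ descendants p x, ∀ b ∉ descendants p x, ∀ a' ∈ descendants p x,
        ∀ b' ∉ descendants p x, a ≠ x → a' ≠ x → a ≠ z → a' ≠ z → G.Adj a b → G.Adj a' b' →
        s(a, b) = s(a', b') := by
      by_cases hex : ∃ a ∈ descendants p x, a ≠ x ∧ ∃ b ∉ descendants p x, G.Adj a b
      · obtain ⟨z, hzx, hzne, w, hw, hzw⟩ := hex
        refine ⟨z, fun a ha b hb a' ha' b' hb' hax hax' haz haz' hab hab' => ?_⟩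
        have h0 := he z hzx w hw hzw (fun h => hzne h.1)
        have h1 := he a ha b hb hab (fun h => hax h.1)
        have h2 := he a' ha' b' hb' hab' (fun h => hax' h.1)
        have h3 : s(z, w) ≠ s(a, b) := fun h => haz (Sym2_cross_eq hzx hb h).1.symm
        have h4 : s(z, w) ≠ s(a', b') := fun h => haz' (Sym2_cross_eq hzx hb' h).1.symm
        grind
      · push Not at hex
        exact ⟨x, fun a ha b hb a' _ b' _ hax _ _ _ hab _ => absurd hab (hex a ha hax b hb)⟩
    refine ⟨insert x (insert z S), Q, hQ, hQd, (hcard2 S z).trans hcard, ?_⟩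
    refine (AcyclicOn.union (A := ((descendants p x ∩ U) \ {x}) \ {z})
      (B := (U \ (descendants p x ∩ U)) \ S) (hW.mono Set.sdiff_subset) hac ?_).mono ?_
    · intro a ha b hb a' ha' b' hb' hab hab'
      exact hz a ha.1.1.1 b (fun h => hb.1.2 ⟨h, hb.1.1⟩) a' ha'.1.1.1 b'
        (fun h => hb'.1.2 ⟨h, hb'.1.1⟩) ha.1.2 ha'.1.2 ha.2 ha'.2 hab hab'
    · rintro u ⟨huU, huS⟩
      simp only [Finset.coe_insert, Set.mem_insert_iff, Finset.mem_coe, not_or] at huS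
      by_cases hu : u ∈ descendants p x
      · exact Or.inl ⟨⟨⟨hu, huU⟩, huS.1⟩, huS.2.1⟩
      · exact Or.inr ⟨⟨huU, fun h => hu h.1⟩, huS.2.2⟩
  -- Deleting `x` cuts `R` off from the rest of `U`, and deleting `z` makes `R` acyclic.
  · obtain ⟨R, hRU, z, hR, hRz, hRx⟩ := hthin.exists_pendant hrank hch hW
    obtain ⟨S, Q, hQ, hQd, hcard, hac⟩ := step R hRU hR
    refine ⟨insert x (insert z S), Q, hQ, hQd, (hcard2 S z).trans hcard, ?_⟩
    refine (AcyclicOn.union (A := R \ {z}) (B := ((U \ R) \ S) \ {x}) hRz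
      (hac.mono Set.sdiff_subset) ?_).mono ?_
    · intro a ha b hb _ _ _ _ hab _
      exact absurd (hRx a ha.1 b hb.1.1 hab) hb.2
    · rintro u ⟨huU, huS⟩
      simp only [Finset.coe_insert, Set.mem_insert_iff, Finset.mem_coe, not_or] at huS
      by_cases hu : u ∈ R
      · exact Or.inl ⟨hu, huS.2.1⟩
      · exact Or.inr ⟨⟨⟨huU, hu⟩, huS.2.2⟩, huS.1⟩

end SimpleGraph

/-! ### Faces across a vertex cut -/

namespace GraphDrawing

variable {V : Type*} {G : SimpleGraph V} (M : GraphDrawing G)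

theorem face_rot (d : G.Dart) : M.face (M.rot d) = M.face d.symm := by
  have := M.face_next d.symm
  rwa [SimpleGraph.Dart.symm_symm] at this

/-- Among the darts that leave a vertex set, a face occurs equally often on either side. -/
theorem ncard_leaving_face [Finite V] (A : Set V) (f : M.Face) :
    {d : G.Dart | d.fst ∈ A ∧ d.snd ∉ A ∧ M.face d = f}.ncard =
      {d : G.Dart | d.fst ∈ A ∧ d.snd ∉ A ∧ M.face d.symm = f}.ncard := by
  classical
  have hfin : Finite G.Dart := Finite.of_injective _ SimpleGraph.Dart.toProd_injective
  -- The rotation permutes the darts starting in `A` and carries the face of `d.symm` to the face of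
  -- the image. Darts inside `A` then cancel by reversal.
  have h1 : {d : G.Dart | d.fst ∈ A ∧ M.face d = f}.ncard =
      {d : G.Dart | d.fst ∈ A ∧ M.face d.symm = f}.ncard := by
    rw [← Set.ncard_image_of_injective {d : G.Dart | d.fst ∈ A ∧ M.face d.symm = f}
      M.rot.injective]
    congr 1
    ext d
    constructor
    · rintro ⟨hd, hf⟩
      refine ⟨M.rot.symm d, ⟨?_, ?_⟩, M.rot.apply_symm_apply d⟩
      · have := M.rot_fst (M.rot.symm d)
        rw [M.rot.apply_symm_apply] at this
        rwa [← this]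
      · rw [← M.face_rot, M.rot.apply_symm_apply, hf]
    · rintro ⟨d, ⟨hd, hf⟩, rfl⟩
      exact ⟨by rwa [M.rot_fst], by rwa [M.face_rot]⟩
  have h2 : {d : G.Dart | d.fst ∈ A ∧ d.snd ∈ A ∧ M.face d = f}.ncard =
      {d : G.Dart | d.fst ∈ A ∧ d.snd ∈ A ∧ M.face d.symm = f}.ncard := by
    rw [← Set.ncard_image_of_injective
      {d : G.Dart | d.fst ∈ A ∧ d.snd ∈ A ∧ M.face d.symm = f}
      SimpleGraph.Dart.symm_involutive.injective]
    congr 1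
    ext d
    constructor
    · rintro ⟨h, h', hf⟩
      exact ⟨d.symm, ⟨h', h, by rwa [SimpleGraph.Dart.symm_symm]⟩, d.symm_symm⟩
    · rintro ⟨d, ⟨h, h', hf⟩, rfl⟩
      exact ⟨h', h, hf⟩
  have split : ∀ P : G.Dart → Prop, {d : G.Dart | d.fst ∈ A ∧ P d}.ncard =
      {d : G.Dart | d.fst ∈ A ∧ d.snd ∈ A ∧ P d}.ncard +
        {d : G.Dart | d.fst ∈ A ∧ d.snd ∉ A ∧ P d}.ncard := by
    intro P
    rw [← Set.ncard_union_eq (Set.disjoint_left.2 fun d h h' => h'.2.1 h.2.1)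
      (Set.toFinite _) (Set.toFinite _)]
    congr 1
    ext d
    simp only [Set.mem_ofPred_eq, Set.mem_union]
    tauto
  have h3 := split fun d => M.face d = f
  have h4 := split fun d => M.face d.symm = f
  omega

/-- If a dart with different faces on its sides leaves a vertex set, then each of these faces is
on a side of a second dart that leaves this set. -/
theorem exists_leaving_face [Finite V] {A : Set V} {f : M.Face} {d : G.Dart} (h1 : d.fst ∈ A)
    (h2 : d.snd ∉ A) (hne : M.face d ≠ M.face d.symm) (hf : M.face d = f ∨ M.face d.symm = f) :
    ∃ d' : G.Dart, d' ≠ d ∧ d'.fst ∈ A ∧ d'.snd ∉ A ∧ (M.face d' = f ∨ M.face d'.symm = f) := by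
  have hfin : Finite G.Dart := Finite.of_injective _ SimpleGraph.Dart.toProd_injective
  have hcard := M.ncard_leaving_face A f
  rcases hf with hf | hf
  · have hpos := (Set.ncard_pos (Set.toFinite _)).2
      (⟨d, h1, h2, hf⟩ : {d : G.Dart | d.fst ∈ A ∧ d.snd ∉ A ∧ M.face d = f}.Nonempty)
    rw [hcard, Set.ncard_pos (Set.toFinite _)] at hpos
    obtain ⟨d', h1', h2', hf'⟩ := hpos
    exact ⟨d', fun h => hne (by rw [hf, ← hf', h]), h1', h2', Or.inr hf'⟩
  · have hpos := (Set.ncard_pos (Set.toFinite _)).2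
      (⟨d, h1, h2, hf⟩ : {d : G.Dart | d.fst ∈ A ∧ d.snd ∉ A ∧ M.face d.symm = f}.Nonempty)
    rw [← hcard, Set.ncard_pos (Set.toFinite _)] at hpos
    obtain ⟨d', h1', h2', hf'⟩ := hpos
    exact ⟨d', fun h => hne (by rw [hf, ← hf', h]), h1', h2', Or.inl hf'⟩

variable {M} {f₀ : M.Face} {e : {f : M.Face // f ≠ f₀} → G.Dart}

theorem edge_injective (he : ∀ f, M.face (e f) = f₀ ∧ M.face (e f).symm = f) :
    Function.Injective fun f => (e f).edge := by
  intro f g hfg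
  rcases SimpleGraph.dart_edge_eq_iff _ _ |>.1 hfg with h | h
  · exact Subtype.ext (by rw [← (he f).2, h, (he g).2])
  · refine absurd ?_ f.2
    rw [← (he f).2, h, SimpleGraph.Dart.symm_symm, (he g).1]

/-- If the chosen edge between `f₀` and `f` leaves a vertex set, then so does an edge on the
boundary of `f` that is none of the chosen ones. -/
theorem exists_leaving_face_not_chosen [Finite V]
    (he : ∀ f, M.face (e f) = f₀ ∧ M.face (e f).symm = f) {A : Set V} {a b : V} (ha : a ∈ A)
    (hb : b ∉ A) {f : {f : M.Face // f ≠ f₀}} (hab : (e f).edge = s(a, b)) :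
    ∃ d : G.Dart, d.fst ∈ A ∧ d.snd ∉ A ∧ d.edge ∉ Set.range (fun g => (e g).edge) ∧
      (M.face d = f ∨ M.face d.symm = f) := by
  obtain ⟨d, hd1, hd2, hdf, hne, hde⟩ : ∃ d : G.Dart, d.fst ∈ A ∧ d.snd ∉ A ∧
      (M.face d = f ∨ M.face d.symm = f) ∧ M.face d ≠ M.face d.symm ∧ d.edge = (e f).edge := by
    obtain ⟨h1, h2⟩ := he f
    have hne : M.face (e f) ≠ M.face (e f).symm := by rw [h1, h2]; exact f.2.symm
    rcases SimpleGraph.dart_edge_eq_mk'_iff'.1 hab with ⟨rfl, rfl⟩ | ⟨rfl, rfl⟩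
    · exact ⟨e f, ha, hb, Or.inr h2, hne, rfl⟩
    · exact ⟨(e f).symm, ha, hb, Or.inl h2, by rw [SimpleGraph.Dart.symm_symm]; exact hne.symm,
        SimpleGraph.Dart.edge_symm _⟩
  obtain ⟨d', hdd', h1, h2, hf⟩ := M.exists_leaving_face hd1 hd2 hne hdf
  refine ⟨d', h1, h2, ?_, hf⟩
  rintro ⟨g, hg⟩
  -- A chosen edge has `f₀` on one side, so if it also borders `f` it is the one chosen for `f`.
  have hgf : g = f := by
    apply Subtype.ext
    have hgf₀ := f.2
    obtain ⟨h3, h4⟩ := he g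
    rcases SimpleGraph.dart_edge_eq_iff _ _ |>.1 hg with h | h
    · rw [h] at h3 h4
      rcases hf with hf | hf
      · exact absurd (hf.symm.trans h3) hgf₀
      · rw [← h4, hf]
    · rw [h] at h3 h4
      rw [SimpleGraph.Dart.symm_symm] at h4
      rcases hf with hf | hf
      · rw [← h4, hf]
      · exact absurd (hf.symm.trans h3) hgf₀
  subst hgf
  rcases SimpleGraph.dart_edge_eq_iff _ _ |>.1 (hde.trans hg) with h | h
  · exact hdd' h.symm
  · rw [h] at hd1
    exact h2 hd1

end GraphDrawing

/-! ### Spanning forests as parent maps -/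

namespace SimpleGraph

variable {V : Type*} {G : SimpleGraph V}

theorem Reachable.exists_adj_dist_lt {u v : V} (h : G.Reachable u v) (hne : u ≠ v) :
    ∃ w, G.Adj u w ∧ G.dist w v < G.dist u v := by
  obtain ⟨c, hc⟩ := h.exists_walk_length_eq_dist
  cases c with
  | nil => exact absurd rfl hne
  | cons hadj c =>
    refine ⟨_, hadj, ?_⟩
    have := dist_le c
    rw [Walk.length_cons] at hc
    omega

/-- A spanning subgraph with the same components as `G` and only `|V| - c(G)` edges consists of the
edges from the vertices to their parents, for some parent map. -/
theorem exists_parent [Finite V] [Nonempty V] {H : SimpleGraph V}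
    (hreach : ∀ u v, G.Reachable u v → H.Reachable u v) (hle : H ≤ G)
    (hcard : Nat.card H.edgeSet + Nat.card G.ConnectedComponent = Nat.card V) :
    ∃ (p : V → V) (rank : V → ℕ) (r : V), (∀ v, p v ≠ v → rank (p v) < rank v) ∧
      (∀ v, p v = v → v = r) ∧ ∀ u v, H.Adj u v → p u = v ∨ p v = u := by
  classical
  let root : V → V := fun v => Quot.out (G.connectedComponentMk v)
  have hroot : ∀ v, G.Reachable v (root v) := fun v =>
    (ConnectedComponent.exact (Quot.out_eq (G.connectedComponentMk v))).symm
  have hroot_eq : ∀ u v, G.Reachable u v → root u = root v := fun u v h => by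
    simp only [root, ConnectedComponent.sound h]
  have hex : ∀ v, root v ≠ v → ∃ w, H.Adj v w ∧ H.dist w (root v) < H.dist v (root v) :=
    fun v hv => (hreach _ _ (hroot v)).exists_adj_dist_lt hv.symm
  let p₀ : V → V := fun v => if h : root v ≠ v then (hex v h).choose else v
  have hp₀ : ∀ v, root v ≠ v → H.Adj v (p₀ v) ∧ H.dist (p₀ v) (root v) < H.dist v (root v) := by
    intro v hv
    simp only [p₀, dif_pos hv]
    exact (hex v hv).choose_spec
  have hroot_p : ∀ v, root v ≠ v → root (p₀ v) = root v := fun v hv =>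
    (hroot_eq _ _ (hle (hp₀ v hv).1).reachable).symm
  let N : Set V := {v | root v ≠ v}
  have hN : N.ncard + Nat.card G.ConnectedComponent = Nat.card V := by
    have h1 : Nᶜ = Set.range (fun c : G.ConnectedComponent => Quot.out c) := by
      ext v
      simp only [N, Set.mem_compl_iff, Set.mem_ofPred_eq, not_not, Set.mem_range]
      constructor
      · exact fun h => ⟨_, h⟩
      · rintro ⟨c, rfl⟩
        exact congrArg Quot.out (Quot.out_eq c)
    have h2 : (Nᶜ).ncard = Nat.card G.ConnectedComponent := by
      rw [h1, ← Nat.card_coe_set_eq]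
      exact Nat.card_range_of_injective fun a b hab => by
        rw [← Quot.out_eq a, ← Quot.out_eq b]
        exact congrArg _ hab
    rw [← h2, Set.ncard_add_ncard_compl]
  -- If two vertices were each other's parents, the distance to their common root would decrease
  -- both ways. By counting, the parent edges are then all of `H`.
  have hinj : Set.InjOn (fun v => s(v, p₀ v)) N := by
    intro u hu v hv huv
    rcases Sym2.eq_iff.1 huv with h | h
    · exact h.1
    · exfalso
      have h1 := (hp₀ u hu).2
      have h2 := (hp₀ v hv).2
      have h3 := hroot_p u hu
      rw [h.2] at h1 h3
      rw [← h.1, h3] at h2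
      omega
  have himg : (fun v => s(v, p₀ v)) '' N = H.edgeSet := by
    refine Set.eq_of_subset_of_ncard_le ?_ ?_ (Set.toFinite _)
    · rintro _ ⟨v, hv, rfl⟩
      exact (hp₀ v hv).1
    · rw [hinj.ncard_image, ← Nat.card_coe_set_eq]
      omega
  obtain ⟨r, hr⟩ : ∃ r, root r = r :=
    ⟨root (Classical.arbitrary V), (hroot_eq _ _ (hroot _)).symm⟩
  -- All component roots are hung below one root `r`, possibly along non-edges; the shift by one
  -- ranks the other roots above `r`.
  refine ⟨fun v => if root v ≠ v then p₀ v else r,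
    fun v => if v = r then 0 else H.dist v (root v) + 1, r, ?_, ?_, ?_⟩
  · intro v hv
    by_cases hvN : root v ≠ v
    · simp only [if_pos hvN] at hv ⊢
      have h1 := (hp₀ v hvN).2
      have hvr : v ≠ r := fun h => hvN (h ▸ hr)
      rw [hroot_p v hvN, if_neg hvr]
      split_ifs <;> omega
    · simp only [if_neg hvN] at hv ⊢
      rw [if_pos trivial, if_neg hv.symm]
      omega
  · intro v hv
    by_cases hvN : root v ≠ v
    · simp only [if_pos hvN] at hv
      have h1 := (hp₀ v hvN).2
      rw [hv] at h1
      exact absurd h1 (lt_irrefl _)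
    · simp only [if_neg hvN] at hv
      exact hv.symm
  · intro u v huv
    have : s(u, v) ∈ (fun v => s(v, p₀ v)) '' N := himg ▸ huv
    obtain ⟨w, hw, hwe⟩ := this
    rcases Sym2.eq_iff.1 hwe with ⟨rfl, rfl⟩ | ⟨rfl, rfl⟩
    · exact Or.inl (if_pos hw)
    · exact Or.inr (if_pos hw)

end SimpleGraph

/-! ### From based planar graphs to the bound -/

namespace SimpleGraph

variable {V : Type*} {G : SimpleGraph V}

/-- The forest consists of the edges not chosen; the two exceptional edges at `v` are those chosen
for the faces beside its parent edge. -/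
theorem IsBasedPlanar.exists_isThinForest [Finite V] [Nonempty V] (hG : G.IsBasedPlanar) :
    ∃ (p : V → V) (rank : V → ℕ) (r : V), G.IsThinForest p ∧
      (∀ v, p v ≠ v → rank (p v) < rank v) ∧ ∀ v, p v = v → v = r := by
  classical
  obtain ⟨M, ⟨-, heuler⟩, f₀, hf₀⟩ := hG
  have hfin := M.finite_face
  choose e₀ he₀ using hf₀
  let e : {f : M.Face // f ≠ f₀} → G.Dart := fun f => e₀ f.1 f.2
  have he : ∀ f, M.face (e f) = f₀ ∧ M.face (e f).symm = f := fun f => he₀ f.1 f.2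
  let J : Set (Sym2 V) := Set.range fun f => (e f).edge
  let H := G.deleteEdges J
  have hJ : J ⊆ G.edgeSet := by
    rintro _ ⟨f, rfl⟩
    exact (e f).edge_mem
  have hJcard : J.ncard + 1 = Nat.card M.Face := by
    have h1 : J.ncard = Nat.card {f : M.Face // f ≠ f₀} := by
      rw [← Nat.card_coe_set_eq]
      exact Nat.card_range_of_injective (GraphDrawing.edge_injective he)
    have h2 := Set.ncard_add_ncard_compl ({f₀} : Set M.Face)
    rw [Set.ncard_singleton, ← Nat.card_coe_set_eq] at h2
    rw [h1, add_comm]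
    exact h2
  have hHcard : Nat.card H.edgeSet + J.ncard = Nat.card G.edgeSet := by
    rw [edgeSet_deleteEdges, Nat.card_coe_set_eq, Nat.card_coe_set_eq,
      Set.ncard_sdiff_add_ncard_of_subset hJ]
  have hcross : ∀ (A : Set V) (a b : V) (f : {f : M.Face // f ≠ f₀}), a ∈ A → b ∉ A →
      (e f).edge = s(a, b) → ∃ d : G.Dart, d.fst ∈ A ∧ d.snd ∉ A ∧ H.Adj d.fst d.snd ∧
      (M.face d = f ∨ M.face d.symm = f) := by
    intro A a b f ha hb hab
    obtain ⟨d, h1, h2, h3, h4⟩ := GraphDrawing.exists_leaving_face_not_chosen he ha hb hab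
    exact ⟨d, h1, h2, deleteEdges_adj.2 ⟨d.adj, h3⟩, h4⟩
  have hadj : ∀ u v, G.Adj u v → H.Reachable u v := by
    intro u v huv
    by_cases h : s(u, v) ∈ J
    · obtain ⟨f, hf⟩ := h
      by_contra hcon
      -- A chosen edge leaving an `H`-component would force an edge of `H` to leave it.
      obtain ⟨d, h1, h2, h3, -⟩ := hcross {w | H.Reachable u w} u v f (Reachable.refl u) hcon hf
      exact h2 (Reachable.trans h1 h3.reachable)
    · exact (deleteEdges_adj.2 ⟨huv, h⟩ : H.Adj u v).reachable
  have hreach : ∀ u v, G.Reachable u v → H.Reachable u v := by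
    rintro u v ⟨c⟩
    induction c with
    | nil => exact Reachable.refl _
    | cons h _ ih => exact (hadj _ _ h).trans ih
  obtain ⟨p, rank, r, hrank, hroot, hp⟩ :=
    -- Euler's formula, with |F| - 1 edges deleted.
    exists_parent hreach (deleteEdges_le J) (by omega)
  refine ⟨p, rank, r, fun v => ?_, hrank, hroot⟩
  have hH : ∀ a ∈ descendants p v, ∀ b ∉ descendants p v, H.Adj a b → a = v ∧ b = p v := by
    intro a ha b hb hab
    rcases hp a b hab with rfl | rfl
    · by_cases hav : a = v
      · exact ⟨hav, by rw [hav]⟩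
      · exact absurd (parent_mem_descendants ha hav) hb
    · exact absurd (mem_descendants_of_parent ha) hb
  by_cases hv : G.Adj v (p v)
  · let t : G.Dart := ⟨(v, p v), hv⟩
    let edgeOf : M.Face → Sym2 V := fun f => if h : f ≠ f₀ then (e ⟨f, h⟩).edge else s(v, v)
    refine ⟨edgeOf (M.face t), edgeOf (M.face t.symm), fun a ha b hb hab hne => ?_⟩
    by_cases h : s(a, b) ∈ J
    · obtain ⟨f, hf⟩ := h
      obtain ⟨d, h1, h2, h3, h4⟩ := hcross _ a b f ha hb hf
      have hdt : d = t := Dart.ext _ _ (Prod.ext_iff.2 (hH _ h1 _ h2 h3))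
      have hedge : edgeOf f = s(a, b) := by
        simp only [edgeOf, dif_pos f.2]
        exact hf
      rw [hdt] at h4
      rcases h4 with h4 | h4
      · left; rw [h4, hedge]
      · right; rw [h4, hedge]
    · exact absurd (hH a ha b hb (deleteEdges_adj.2 ⟨hab, h⟩)) hne
  -- Without a parent edge in `G`, no forest edge leaves the descendants, hence no edge at all.
  · refine ⟨s(v, v), s(v, v), fun a ha b hb hab hne => ?_⟩
    exfalso
    by_cases h : s(a, b) ∈ J
    · obtain ⟨f, hf⟩ := h
      obtain ⟨d, h1, h2, h3, -⟩ := hcross _ a b f ha hb hf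
      obtain ⟨h4, h5⟩ := hH _ h1 _ h2 h3
      exact hv (by simpa only [h4, h5] using d.adj)
    · exact hne (hH a ha b hb (deleteEdges_adj.2 ⟨hab, h⟩))

/-- Pairwise disjoint vertex sets that contain cycles yield a cycle packing. -/
theorem exists_isCyclePacking_of_disjoint {Q : Finset (Set V)}
    (hQ : ∀ A ∈ Q, ¬ G.AcyclicOn A) (hQd : (Q : Set (Set V)).Pairwise Disjoint) :
    ∃ P : Finset G.Subgraph, G.IsCyclePacking P ∧ P.card = Q.card := by
  classical
  have hex : ∀ A : Q, ∃ K : G.Subgraph, K.IsCycleSubgraph ∧ K.verts ⊆ A := by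
    rintro ⟨A, hA⟩
    have := hQ A hA
    simp only [AcyclicOn, not_forall, not_exists, not_and, not_not] at this
    obtain ⟨v, c, hc, hcA⟩ := this
    refine ⟨c.toSubgraph, ⟨v, c, hc, rfl⟩, fun w hw => hcA w ?_⟩
    rwa [Walk.mem_verts_toSubgraph] at hw
  choose K hK hKA using hex
  have hne : ∀ A, (K A).verts.Nonempty := by
    intro A
    obtain ⟨v, c, -, hc⟩ := hK A
    exact ⟨v, by rw [hc, Walk.mem_verts_toSubgraph]; exact c.start_mem_support⟩
  have hdisj : ∀ A B : Q, A ≠ B → Disjoint (K A).verts (K B).verts := fun A B hAB =>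
    (hQd A.2 B.2 fun h => hAB (Subtype.ext h)).mono (hKA A) (hKA B)
  have hinj : Function.Injective K := by
    intro A B hAB
    by_contra hne'
    have := hdisj A B hne'
    rw [hAB, disjoint_self] at this
    exact (hne B).ne_empty this
  refine ⟨Finset.univ.image K, ⟨?_, ?_⟩, ?_⟩
  · intro H hH
    obtain ⟨A, -, rfl⟩ := Finset.mem_image.1 hH
    exact hK A
  · intro H hH H' hH' hne'
    obtain ⟨A, -, rfl⟩ := Finset.mem_image.1 (Finset.mem_coe.1 hH)
    obtain ⟨B, -, rfl⟩ := Finset.mem_image.1 (Finset.mem_coe.1 hH')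
    exact hdisj A B fun h => hne' (congrArg K h)
  · rw [Finset.card_image_of_injective _ hinj, Finset.card_univ, Fintype.card_coe]

theorem IsBasedPlanar.exists_isCyclePacking_isFeedbackVertexSet [Finite V]
    (hG : G.IsBasedPlanar) : ∃ (P : Finset G.Subgraph) (S : Finset V),
      G.IsCyclePacking P ∧ G.IsFeedbackVertexSet S ∧ S.card ≤ 2 * P.card := by
  cases isEmpty_or_nonempty V
  · exact ⟨∅, ∅, by simp [IsCyclePacking], fun v => isEmptyElim v.1, by simp⟩
  obtain ⟨p, rank, r, hthin, hrank, hroot⟩ := hG.exists_isThinForest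
  obtain ⟨S, Q, hQ, hQd, hcard, hac⟩ := hthin.exists_packing hrank hroot Set.univ
  obtain ⟨P, hP, hPQ⟩ := exists_isCyclePacking_of_disjoint (fun A hA => (hQ A hA).2) hQd
  exact ⟨P, S, hP, (hac.mono fun v hv => ⟨trivial, hv⟩).isAcyclic_induce, by omega⟩

theorem IsCyclePacking.card_le_cyclePackingNumber [Finite V] {P : Finset G.Subgraph}
    (hP : G.IsCyclePacking P) : P.card ≤ G.cyclePackingNumber := by
  have := Fintype.ofFinite G.Subgraph
  refine le_csSup ⟨Fintype.card G.Subgraph, ?_⟩ ⟨P, hP, rfl⟩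
  rintro n ⟨Q, -, rfl⟩
  exact Q.card_le_univ

theorem IsCyclePacking.subset {P Q : Finset G.Subgraph} (hP : G.IsCyclePacking P) (h : Q ⊆ P) :
    G.IsCyclePacking Q :=
  ⟨fun H hH => hP.1 H (h hH), hP.2.mono (Finset.coe_subset.2 h)⟩

end SimpleGraph

theorem mainTheorem1 {V : Type*} [Finite V] (G : SimpleGraph V) (hG : G.IsBasedPlanar) :
    G.feedbackVertexNumber ≤ 2 * G.cyclePackingNumber ∧
      ∀ k : ℕ, (¬ ∃ P : Finset G.Subgraph, G.IsCyclePacking P ∧ P.card = k + 1) →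
        ∃ S : Finset V, S.card ≤ 2 * k ∧ G.IsFeedbackVertexSet S := by
  obtain ⟨P, S, hP, hS, hcard⟩ := hG.exists_isCyclePacking_isFeedbackVertexSet
  constructor
  · have h1 : G.feedbackVertexNumber ≤ S.card := Nat.sInf_le ⟨S, hS, rfl⟩
    have h2 := hP.card_le_cyclePackingNumber
    omega
  · intro k hk
    refine ⟨S, ?_, hS⟩
    by_contra hlt
    obtain ⟨Q, hQP, hQ⟩ := Finset.exists_subset_card_eq (s := P) (n := k + 1) (by omega)
    exact hk ⟨Q, hP.subset hQP, hQ⟩
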